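/- **Weak maximum principle.** Let $N\ge 3$, let $\Omega\subset\mathbb R^N$ be a bounded open set with $0\in\Omega$, and let $0<s<1$, $\lambda>0$, $1<p<2^*$ with $2^*=\frac{2N}{N-2}$, and $0<\mu<\bar\mu$ with $\bar\mu=\left(\frac{N-2}{2}\right)^2$. Let $$X(\Omega)=\{u\in H^1(\mathbb R^N):\ u|_\Omega\in H^1_0(\Omega),\ u=0\text{ a.e. in }\mathbb R^N\setminus\Omega\},\qquad \langle u,v\rangle_s=\iint_{\mathbb R^{2N}}\frac{(u(x)-u(y))(v(x)-v(y))}{|x-y|^{N+2s}}\,dx\,dy ,$$ and write $u^+=\max\{u,0\}$. Consider the problem $$-\Delta u+(-\Delta)^s u-\mu\frac{u}{|x|^2}=(u^+)^{2^*-1}+\lambda (u^+)^{p-1}\ \text{ in }\Omega,\qquad u=0\ \text{ in }\mathbb R^N\setminus\Omega. \tag{$P^+_{\mu,\lambda}$}$$ A function $u\in X(\Omega)$ is a weak supersolution of $(P^+_{\mu,\lambda})$ if, for every $v\in X(\Omega)$ with $v\ge 0$ a.e. in $\Omega$, $$\int_\Omega \nabla u\cdot\nabla v\,dx+\langle u,v\rangle_s-\mu\int_\Omega\frac{uv}{|x|^2}\,dx\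 \ge\ \int_\Omega (u^+)^{2^*-1}v\,dx+\lambda\int_\Omega (u^+)^{p-1}v\,dx .$$ If $u\in X(\Omega)$ is a weak supersolution of $(P^+_{\mu,\lambda})$, then $u\ge 0$ a.e. in $\Omega$. -/

import Mathlib

open MeasureTheory Filter Topology
open TopologicalSpace (Opens)
open scoped Distributions

noncomputable section

namespace MixedHardy

/-- `G` is a weak (distributional) gradient of `u` on the open set `Ω`: both are locally integrable
on `Ω` and `∫_Ω u ∂ᵢφ = - ∫_Ω Gᵢ φ` for all `φ ∈ C_c^∞(Ω)` and all `i`. -/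
def HasWeakGradient {N : ℕ} (Ω : Opens (EuclideanSpace ℝ (Fin N)))
    (u : EuclideanSpace ℝ (Fin N) → ℝ)
    (G : EuclideanSpace ℝ (Fin N) → EuclideanSpace ℝ (Fin N)) : Prop :=
  LocallyIntegrableOn u (Ω : Set (EuclideanSpace ℝ (Fin N))) ∧
  LocallyIntegrableOn G (Ω : Set (EuclideanSpace ℝ (Fin N))) ∧
  ∀ (φ : 𝓓(Ω, ℝ)) (i : Fin N),
    ∫ x in (Ω : Set (EuclideanSpace ℝ (Fin N))),
        u x * fderiv ℝ φ x (EuclideanSpace.single i 1) =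
      - ∫ x in (Ω : Set (EuclideanSpace ℝ (Fin N))), G x i * φ x

/-- Weak gradients are unique up to null sets. -/
theorem HasWeakGradient.ae_eq {N : ℕ} {Ω : Opens (EuclideanSpace ℝ (Fin N))}
    {u : EuclideanSpace ℝ (Fin N) → ℝ}
    {G H : EuclideanSpace ℝ (Fin N) → EuclideanSpace ℝ (Fin N)}
    (hG : HasWeakGradient Ω u G) (hH : HasWeakGradient Ω u H) :
    ∀ᵐ x ∂(volume.restrict (Ω : Set (EuclideanSpace ℝ (Fin N)))), G x = H x := by
  have hcoord : ∀ {K : EuclideanSpace ℝ (Fin N) → EuclideanSpace ℝ (Fin N)},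
      LocallyIntegrableOn K (Ω : Set (EuclideanSpace ℝ (Fin N))) → ∀ i,
      LocallyIntegrableOn (fun x => K x i) (Ω : Set (EuclideanSpace ℝ (Fin N))) := by
    intro K hK i x hx
    obtain ⟨t, ht, hi⟩ := hK x hx
    exact ⟨t, ht, (EuclideanSpace.proj (𝕜 := ℝ) i).integrable_comp hi⟩
  have key : ∀ i, ∀ᵐ x ∂volume, x ∈ (Ω : Set (EuclideanSpace ℝ (Fin N))) →
      G x i - H x i = 0 := by
    intro i
    refine IsOpen.ae_eq_zero_of_integral_contDiff_smul_eq_zero Ω.isOpen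
      ((hcoord hG.2.1 i).sub (hcoord hH.2.1 i)) ?_
    intro g hg hgc hgs
    let φ : 𝓓(Ω, ℝ) := ⟨g, hg, hgc, hgs⟩
    have hint : ∀ {K : EuclideanSpace ℝ (Fin N) → EuclideanSpace ℝ (Fin N)},
        LocallyIntegrableOn K (Ω : Set (EuclideanSpace ℝ (Fin N))) →
        Integrable (fun x => g x • K x i) volume := by
      intro K hK
      exact TestFunction.integrable_bilin (𝕜 := ℝ) (ContinuousLinearMap.lsmul ℝ ℝ)
        (hcoord hK i) φ
    have hset : ∀ K : EuclideanSpace ℝ (Fin N) → EuclideanSpace ℝ (Fin N),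
        ∫ x in (Ω : Set (EuclideanSpace ℝ (Fin N))), K x i * φ x = ∫ x, g x • K x i := by
      intro K
      rw [setIntegral_eq_integral_of_forall_compl_eq_zero]
      · exact integral_congr_ae (Eventually.of_forall fun x => mul_comm _ _)
      · intro x hx
        have : g x = 0 := image_eq_zero_of_notMem_tsupport fun h => hx (hgs h)
        change K x i * g x = 0
        rw [this, mul_zero]
    have h1 := hG.2.2 φ i
    have h2 := hH.2.2 φ i
    rw [hset] at h1 h2
    have : ∫ x, g x • G x i = ∫ x, g x • H x i := by linarith
    calc ∫ x, g x • (((fun x => G x i) - fun x => H x i) x)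
        = ∫ x, (g x • G x i - g x • H x i) := by simp [mul_sub]
      _ = 0 := by rw [integral_sub (hint hG.2.1) (hint hH.2.1), this, sub_self]
  rw [ae_restrict_iff' Ω.isOpen.measurableSet]
  filter_upwards [ae_all_iff.2 key] with x hx hxΩ
  ext i
  exact sub_eq_zero.1 (hx i hxΩ)

open Classical in
/-- The weak gradient `∇u` on `Ω` (well defined almost everywhere, see `HasWeakGradient.ae_eq`;
zero if there is none). -/
def weakGradient {N : ℕ} (Ω : Opens (EuclideanSpace ℝ (Fin N)))
    (u : EuclideanSpace ℝ (Fin N) → ℝ) :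
    EuclideanSpace ℝ (Fin N) → EuclideanSpace ℝ (Fin N) :=
  if h : ∃ G, HasWeakGradient Ω u G then h.choose else 0

/-- `u|_Ω ∈ H¹(Ω)`. For `Ω = ⊤` this is `u ∈ H¹(ℝᴺ)`. -/
def MemH1 {N : ℕ} (Ω : Opens (EuclideanSpace ℝ (Fin N)))
    (u : EuclideanSpace ℝ (Fin N) → ℝ) : Prop :=
  MemLp u 2 (volume.restrict (Ω : Set (EuclideanSpace ℝ (Fin N)))) ∧
  ∃ G, HasWeakGradient Ω u G ∧
    MemLp G 2 (volume.restrict (Ω : Set (EuclideanSpace ℝ (Fin N))))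

/-- `u|_Ω ∈ H¹₀(Ω)`, the closure of `C_c^∞(Ω)` in `H¹(Ω)`. -/
def MemH10 {N : ℕ} (Ω : Opens (EuclideanSpace ℝ (Fin N)))
    (u : EuclideanSpace ℝ (Fin N) → ℝ) : Prop :=
  MemH1 Ω u ∧
  ∃ φ : ℕ → 𝓓(Ω, ℝ),
    Tendsto (fun n => eLpNorm (fun x => φ n x - u x) 2
      (volume.restrict (Ω : Set (EuclideanSpace ℝ (Fin N))))) atTop (𝓝 0) ∧
    Tendsto (fun n => eLpNorm (fun x => gradient (φ n) x - weakGradient Ω u x) 2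
      (volume.restrict (Ω : Set (EuclideanSpace ℝ (Fin N))))) atTop (𝓝 0)

/-- The space `X(Ω)` of all `u ∈ H¹(ℝᴺ)` with `u|_Ω ∈ H¹₀(Ω)` and `u = 0` a.e. in `ℝᴺ ∖ Ω`. -/
def MemX {N : ℕ} (Ω : Opens (EuclideanSpace ℝ (Fin N)))
    (u : EuclideanSpace ℝ (Fin N) → ℝ) : Prop :=
  MemH1 ⊤ u ∧ MemH10 Ω u ∧
  ∀ᵐ x ∂(volume.restrict ((Ω : Set (EuclideanSpace ℝ (Fin N)))ᶜ)), u x = 0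

/-- `⟨u, v⟩ₛ = ∬ (u(x) - u(y)) (v(x) - v(y)) / |x - y|^(N + 2s) dx dy` over `ℝᴺ × ℝᴺ`. -/
def gagliardoInner {N : ℕ} (s : ℝ) (u v : EuclideanSpace ℝ (Fin N) → ℝ) : ℝ :=
  ∫ z : EuclideanSpace ℝ (Fin N) × EuclideanSpace ℝ (Fin N),
    (u z.1 - u z.2) * (v z.1 - v z.2) / ‖z.1 - z.2‖ ^ ((N : ℝ) + 2 * s)

/-- The critical Sobolev exponent `2* = 2N / (N - 2)`. -/
def criticalExponent (N : ℕ) : ℝ := 2 * (N : ℝ) / ((N : ℝ) - 2)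

/-- The Hardy constant `((N - 2) / 2)²`. -/
def hardyConstant (N : ℕ) : ℝ := (((N : ℝ) - 2) / 2) ^ 2

/-- `u ∈ X(Ω)` is a weak supersolution of
`-Δu + (-Δ)ˢu - μ u / |x|² = (u⁺)^(2* - 1) + λ (u⁺)^(p - 1)` in `Ω`, `u = 0` in `ℝᴺ ∖ Ω`:
the weak inequality `≥` holds against all nonnegative `v ∈ X(Ω)`. -/
def IsWeakSupersolution {N : ℕ} (Ω : Opens (EuclideanSpace ℝ (Fin N))) (s μ lam p : ℝ)
    (u : EuclideanSpace ℝ (Fin N) → ℝ) : Prop :=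
  MemX Ω u ∧
  ∀ v : EuclideanSpace ℝ (Fin N) → ℝ, MemX Ω v →
    (∀ᵐ x ∂(volume.restrict (Ω : Set (EuclideanSpace ℝ (Fin N)))), 0 ≤ v x) →
    (∫ x in (Ω : Set (EuclideanSpace ℝ (Fin N))),
          (max (u x) 0) ^ (criticalExponent N - 1) * v x)
        + lam * (∫ x in (Ω : Set (EuclideanSpace ℝ (Fin N))), (max (u x) 0) ^ (p - 1) * v x)
      ≤ (∫ x in (Ω : Set (EuclideanSpace ℝ (Fin N))),
            inner ℝ (weakGradient Ω u x) (weakGradient Ω v x))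
          + gagliardoInner s u v
          - μ * (∫ x in (Ω : Set (EuclideanSpace ℝ (Fin N))), u x * v x / ‖x‖ ^ 2)

end MixedHardy

end

noncomputable section

namespace MixedHardy

open scoped ENNReal ContDiff

variable {N : ℕ} {Ω : Opens (EuclideanSpace ℝ (Fin N))}

/-! Test the supersolution inequality with the negative part `u⁻ = max (-u) 0`. Both nonlinear terms
vanish, since `u⁺` and `u⁻` have disjoint supports; the Gagliardo term is nonpositive, since `t ↦
t⁻` is decreasing; the gradient term is at most `-∫ |∇u⁻|²`; and `-μ ∫ u u⁻ / |x|²` equals `μ ∫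
(u⁻)² / |x|²`. Hence `∫ |∇u⁻|² ≤ μ ∫ (u⁻)² / |x|²`. Hardy's inequality bounds the left side below by
`hardyConstant N` times the same integral, and `μ < hardyConstant N` forces `u⁻ = 0` a.e.

Two facts carry this: `u⁻ ∈ X(Ω)` (`IsTestLimit.negPart`) and Hardy's inequality with the sharp
constant (`IsTestLimit.hardy`). Both are limits of statements about test functions, so `X(Ω)` is
handled through `IsTestLimit`: a function and a field on all of `ℝᴺ` approximated in `L²` by test
functions on `Ω` and their gradients. `MemX.isTestLimit` and `IsTestLimit.memX` translate between
the two. -/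

/-- Dominated convergence in `L²`. -/
theorem tendsto_eLpNorm_two_zero_of_dominated {α F : Type*} [MeasurableSpace α] {ν : Measure α}
    [NormedAddCommGroup F] {f : ℕ → α → F} {g : α → F}
    (hf : ∀ n, AEStronglyMeasurable (f n) ν) (hg : MemLp g 2 ν)
    (hle : ∀ n, ∀ᵐ x ∂ν, ‖f n x‖ ≤ ‖g x‖)
    (hlim : ∀ᵐ x ∂ν, Tendsto (fun n => f n x) atTop (𝓝 0)) :
    Tendsto (fun n => eLpNorm (f n) 2 ν) atTop (𝓝 0) := by
  have key : Tendsto (fun n => ∫⁻ x, ‖f n x‖ₑ ^ (2 : ℝ) ∂ν) atTop (𝓝 (∫⁻ _, 0 ∂ν)) := by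
    refine tendsto_lintegral_of_dominated_convergence' (fun x => ‖g x‖ₑ ^ (2 : ℝ))
      (fun n => (hf n).enorm.pow_const _) (fun n => ?_) ?_ ?_
    · filter_upwards [hle n] with x hx
      exact ENNReal.rpow_le_rpow (enorm_le_iff_norm_le.2 hx) (by norm_num)
    · have := lintegral_rpow_enorm_lt_top_of_eLpNorm_lt_top (p := 2) (by norm_num) (by norm_num) hg.2
      simpa using this.ne
    · filter_upwards [hlim] with x hx
      have h1 : Tendsto (fun n => ‖f n x‖ₑ) atTop (𝓝 0) := by simpa using hx.enorm
      have h2 := (ENNReal.continuous_rpow_const (y := (2 : ℝ))).tendsto (0 : ℝ≥0∞) |>.comp h1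
      simpa [Function.comp_def] using h2
  have h3 := (ENNReal.continuous_rpow_const (y := (1 / 2 : ℝ))).tendsto _ |>.comp key
  simp only [lintegral_zero] at h3
  rw [ENNReal.zero_rpow_of_pos (by norm_num)] at h3
  refine h3.congr fun n => ?_
  rw [eLpNorm_eq_lintegral_rpow_enorm_toReal (by norm_num) (by norm_num)]
  simp

/-! ### Test functions and their `L²` limits. -/

theorem memLp_testFunction {Ω : Opens (EuclideanSpace ℝ (Fin N))} (φ : 𝓓(Ω, ℝ)) :
    MemLp φ 2 volume :=
  φ.continuous.memLp_of_hasCompactSupport φ.hasCompactSupport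

theorem gradient_apply_eq (f : EuclideanSpace ℝ (Fin N) → ℝ) (x : EuclideanSpace ℝ (Fin N))
    (i : Fin N) : gradient f x i = fderiv ℝ f x (EuclideanSpace.single i 1) := by
  have h : inner ℝ (gradient f x) (EuclideanSpace.single i (1 : ℝ))
      = fderiv ℝ f x (EuclideanSpace.single i 1) := by
    rw [gradient, InnerProductSpace.toDual_symm_apply]
  rw [← h, EuclideanSpace.inner_single_right]
  simp

theorem continuous_gradient {f : EuclideanSpace ℝ (Fin N) → ℝ} (hf : ContDiff ℝ ∞ f) :
    Continuous (gradient f) :=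
  (InnerProductSpace.toDual ℝ _).symm.continuous.comp (hf.continuous_fderiv (by simp))

theorem gradient_eq_zero_of_notMem_tsupport {f : EuclideanSpace ℝ (Fin N) → ℝ}
    {x : EuclideanSpace ℝ (Fin N)} (hx : x ∉ tsupport f) : gradient f x = 0 := by
  rw [gradient, fderiv_of_notMem_tsupport ℝ hx, map_zero]

theorem hasCompactSupport_gradient {f : EuclideanSpace ℝ (Fin N) → ℝ} (hf : HasCompactSupport f) :
    HasCompactSupport (gradient f) :=
  HasCompactSupport.intro hf fun _ hx => gradient_eq_zero_of_notMem_tsupport hx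

/-- `w` and `G` are the limits in `L²(ℝᴺ)` of `φₙ` and `∇φₙ` for test functions `φₙ` on `Ω`. -/
structure IsTestLimit (Ω : Opens (EuclideanSpace ℝ (Fin N)))
    (w : EuclideanSpace ℝ (Fin N) → ℝ)
    (G : EuclideanSpace ℝ (Fin N) → EuclideanSpace ℝ (Fin N)) : Prop where
  memLp : MemLp w 2 volume
  memLp_grad : MemLp G 2 volume
  exists_le : ∀ ε : ℝ≥0∞, ε ≠ 0 → ∃ φ : 𝓓(Ω, ℝ),
    eLpNorm (fun x => φ x - w x) 2 volume ≤ ε ∧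
    eLpNorm (fun x => gradient φ x - G x) 2 volume ≤ ε

theorem memLp_gradient (φ : 𝓓(Ω, ℝ)) : MemLp (gradient φ) 2 volume :=
  (continuous_gradient φ.contDiff).memLp_of_hasCompactSupport
    (hasCompactSupport_gradient φ.hasCompactSupport)

theorem IsTestLimit.exists_seq {w : EuclideanSpace ℝ (Fin N) → ℝ}
    {G : EuclideanSpace ℝ (Fin N) → EuclideanSpace ℝ (Fin N)} (h : IsTestLimit Ω w G) :
    ∃ φ : ℕ → 𝓓(Ω, ℝ),
      Tendsto (fun n => eLpNorm (fun x => φ n x - w x) 2 volume) atTop (𝓝 0) ∧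
      Tendsto (fun n => eLpNorm (fun x => gradient (φ n) x - G x) 2 volume) atTop (𝓝 0) := by
  choose φ h1 h2 using fun n : ℕ => h.exists_le ((n : ℝ≥0∞)⁻¹) (by simp)
  exact ⟨φ, tendsto_of_tendsto_of_tendsto_of_le_of_le tendsto_const_nhds
    ENNReal.tendsto_inv_nat_nhds_zero (fun _ => zero_le) h1,
    tendsto_of_tendsto_of_tendsto_of_le_of_le tendsto_const_nhds
    ENNReal.tendsto_inv_nat_nhds_zero (fun _ => zero_le) h2⟩

theorem isTestLimit_of_tendsto {w : EuclideanSpace ℝ (Fin N) → ℝ}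
    {G : EuclideanSpace ℝ (Fin N) → EuclideanSpace ℝ (Fin N)} (hw : MemLp w 2 volume)
    (hG : MemLp G 2 volume) (φ : ℕ → 𝓓(Ω, ℝ))
    (h1 : Tendsto (fun n => eLpNorm (fun x => φ n x - w x) 2 volume) atTop (𝓝 0))
    (h2 : Tendsto (fun n => eLpNorm (fun x => gradient (φ n) x - G x) 2 volume) atTop (𝓝 0)) :
    IsTestLimit Ω w G := by
  refine ⟨hw, hG, fun ε hε => ?_⟩
  obtain ⟨n, hn1, hn2⟩ := ((h1.eventually_lt_const (pos_iff_ne_zero.2 hε)).and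
    (h2.eventually_lt_const (pos_iff_ne_zero.2 hε))).exists
  exact ⟨φ n, hn1.le, hn2.le⟩

/-- A sequential `L²`-limit of pairs in `IsTestLimit` is again one. -/
theorem IsTestLimit.of_tendsto {w : EuclideanSpace ℝ (Fin N) → ℝ}
    {G : EuclideanSpace ℝ (Fin N) → EuclideanSpace ℝ (Fin N)}
    {wn : ℕ → EuclideanSpace ℝ (Fin N) → ℝ}
    {Gn : ℕ → EuclideanSpace ℝ (Fin N) → EuclideanSpace ℝ (Fin N)}
    (h : ∀ n, IsTestLimit Ω (wn n) (Gn n)) (hw : MemLp w 2 volume) (hG : MemLp G 2 volume)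
    (h1 : Tendsto (fun n => eLpNorm (wn n - w) 2 volume) atTop (𝓝 0))
    (h2 : Tendsto (fun n => eLpNorm (Gn n - G) 2 volume) atTop (𝓝 0)) :
    IsTestLimit Ω w G := by
  refine ⟨hw, hG, fun ε hε => ?_⟩
  have hε2 : ε / 2 ≠ 0 := (ENNReal.half_pos hε).ne'
  obtain ⟨n, hn1, hn2⟩ := ((h1.eventually_lt_const (pos_iff_ne_zero.2 hε2)).and
    (h2.eventually_lt_const (pos_iff_ne_zero.2 hε2))).exists
  obtain ⟨φ, hφ1, hφ2⟩ := (h n).exists_le (ε / 2) hε2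
  refine ⟨φ, ?_, ?_⟩
  · have : (fun x => φ x - w x) = (fun x => φ x - wn n x) + (wn n - w) := by ext; simp
    rw [this, ← ENNReal.add_halves ε]
    exact (eLpNorm_add_le ((memLp_testFunction φ).1.sub (h n).memLp.1)
      ((h n).memLp.1.sub hw.1) (by norm_num)).trans (add_le_add hφ1 hn1.le)
  · have : (fun x => gradient φ x - G x) = (fun x => gradient φ x - Gn n x) + (Gn n - G) := by
      ext; simp
    rw [this, ← ENNReal.add_halves ε]
    exact (eLpNorm_add_le ((memLp_gradient φ).1.sub (h n).memLp_grad.1)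
      ((h n).memLp_grad.1.sub hG.1) (by norm_num)).trans (add_le_add hφ2 hn2.le)

/-! ### Limits of test functions and the space `X(Ω)`. -/

theorem HasWeakGradient.weakGradient_ae_eq {u : EuclideanSpace ℝ (Fin N) → ℝ}
    {G : EuclideanSpace ℝ (Fin N) → EuclideanSpace ℝ (Fin N)} (h : HasWeakGradient Ω u G) :
    weakGradient Ω u =ᵐ[volume.restrict (Ω : Set (EuclideanSpace ℝ (Fin N)))] G := by
  have hex : ∃ G, HasWeakGradient Ω u G := ⟨G, h⟩
  rw [weakGradient, dif_pos hex]
  exact hex.choose_spec.ae_eq h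

/-- Off `Ω` the test functions, their gradients, `u` (a.e.) and the truncated gradient all vanish,
so `L²(Ω)` and `L²(ℝᴺ)` distances agree. -/
theorem MemX.isTestLimit {u : EuclideanSpace ℝ (Fin N) → ℝ} (h : MemX Ω u) :
    IsTestLimit Ω u
      ((Ω : Set (EuclideanSpace ℝ (Fin N))).indicator (weakGradient Ω u)) := by
  obtain ⟨⟨hu2, -⟩, ⟨⟨-, G, hG, hG2⟩, φ, h1, h2⟩, h0⟩ := h
  have hm : MeasurableSet (Ω : Set (EuclideanSpace ℝ (Fin N))) := Ω.isOpen.measurableSet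
  refine isTestLimit_of_tendsto (by simpa using hu2)
    ((memLp_indicator_iff_restrict hm).2 ((memLp_congr_ae hG.weakGradient_ae_eq).2 hG2)) φ ?_ ?_
  · refine h1.congr fun n => ?_
    rw [← eLpNorm_indicator_eq_eLpNorm_restrict hm]
    refine eLpNorm_congr_ae ?_
    filter_upwards [(ae_restrict_iff' hm.compl).1 h0] with x hx
    by_cases hxΩ : x ∈ (Ω : Set (EuclideanSpace ℝ (Fin N)))
    · simp [hxΩ]
    · have : φ n x = 0 := image_eq_zero_of_notMem_tsupport fun h => hxΩ ((φ n).tsupport_subset h)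
      rw [Set.indicator_of_notMem hxΩ, hx hxΩ, this, sub_zero]
  · refine h2.congr fun n => ?_
    rw [← eLpNorm_indicator_eq_eLpNorm_restrict hm]
    refine eLpNorm_congr_ae (.of_forall fun x => ?_)
    by_cases hxΩ : x ∈ (Ω : Set (EuclideanSpace ℝ (Fin N)))
    · simp [hxΩ]
    · have : gradient (φ n) x = 0 :=
        gradient_eq_zero_of_notMem_tsupport fun h => hxΩ ((φ n).tsupport_subset h)
      simp only [Set.indicator_of_notMem hxΩ, this, sub_zero]

theorem tendsto_integral_mul_of_tendsto_eLpNorm_two {α : Type*} [MeasurableSpace α]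
    {ν : Measure α} {f : ℕ → α → ℝ} {f₀ g : α → ℝ} (hf : ∀ n, MemLp (f n) 2 ν)
    (hf₀ : MemLp f₀ 2 ν) (hg : MemLp g 2 ν)
    (h : Tendsto (fun n => eLpNorm (fun x => f n x - f₀ x) 2 ν) atTop (𝓝 0)) :
    Tendsto (fun n => ∫ x, f n x * g x ∂ν) atTop (𝓝 (∫ x, f₀ x * g x ∂ν)) := by
  refine tendsto_integral_of_L1' (fun x => f₀ x * g x) (hf₀.integrable_mul hg).1
    (.of_forall fun n => (hf n).integrable_mul hg) ?_
  have h1 : Tendsto (fun n => eLpNorm (fun x => f n x - f₀ x) 2 ν * eLpNorm g 2 ν) atTop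
      (𝓝 0) := by
    simpa using ENNReal.Tendsto.mul_const h (.inr hg.2.ne)
  refine tendsto_of_tendsto_of_tendsto_of_le_of_le tendsto_const_nhds h1 (fun _ => zero_le)
    fun n => ?_
  have := eLpNorm_smul_le_mul_eLpNorm (p := 2) (q := 2) (r := 1) hg.1 ((hf n).1.sub hf₀.1)
  refine le_of_eq_of_le ?_ this
  congr 1
  ext x
  simp [sub_mul]

theorem memLp_euclidean_apply {G : EuclideanSpace ℝ (Fin N) → EuclideanSpace ℝ (Fin N)}
    {ν : Measure (EuclideanSpace ℝ (Fin N))} (hG : MemLp G 2 ν) (i : Fin N) :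
    MemLp (fun x => G x i) 2 ν :=
  hG.of_le ((EuclideanSpace.proj (𝕜 := ℝ) i).continuous.comp_aestronglyMeasurable hG.1)
    (.of_forall fun x => PiLp.norm_apply_le (G x) i)

theorem continuous_fderiv_single {f : EuclideanSpace ℝ (Fin N) → ℝ} (hf : ContDiff ℝ ∞ f)
    (i : Fin N) : Continuous fun x => fderiv ℝ f x (EuclideanSpace.single i 1) :=
  (hf.continuous_fderiv (by simp)).clm_apply continuous_const

theorem hasCompactSupport_fderiv_single {f : EuclideanSpace ℝ (Fin N) → ℝ}
    (hf : HasCompactSupport f) (i : Fin N) :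
    HasCompactSupport fun x => fderiv ℝ f x (EuclideanSpace.single i 1) :=
  HasCompactSupport.intro hf fun x hx => by simp [fderiv_of_notMem_tsupport ℝ hx]

/-- Integration by parts holds for the approximating test functions, and both sides are
`L²`-continuous. The support of `f` may leave `Ω`: this makes `G` a weak gradient on all of `ℝᴺ`. -/
theorem IsTestLimit.integral_mul_fderiv {w : EuclideanSpace ℝ (Fin N) → ℝ}
    {G : EuclideanSpace ℝ (Fin N) → EuclideanSpace ℝ (Fin N)} (h : IsTestLimit Ω w G)
    {f : EuclideanSpace ℝ (Fin N) → ℝ} (hf : ContDiff ℝ ∞ f) (hfc : HasCompactSupport f)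
    (i : Fin N) :
    ∫ x, w x * fderiv ℝ f x (EuclideanSpace.single i 1) = - ∫ x, G x i * f x := by
  obtain ⟨φ, h1, h2⟩ := h.exists_seq
  have hf2 : MemLp f 2 volume := hf.continuous.memLp_of_hasCompactSupport hfc
  have hdf2 : MemLp (fun x => fderiv ℝ f x (EuclideanSpace.single i 1)) 2 volume :=
    (continuous_fderiv_single hf i).memLp_of_hasCompactSupport
      (hasCompactSupport_fderiv_single hfc i)
  have hφ2 : ∀ n, MemLp (fun x => gradient (φ n) x i) 2 volume := fun n =>
    memLp_euclidean_apply (memLp_gradient (φ n)) i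
  have t1 := tendsto_integral_mul_of_tendsto_eLpNorm_two (fun n => memLp_testFunction (φ n))
    h.memLp hdf2 h1
  have t2 := tendsto_integral_mul_of_tendsto_eLpNorm_two hφ2
    (memLp_euclidean_apply h.memLp_grad i) hf2 (by
      refine tendsto_of_tendsto_of_tendsto_of_le_of_le tendsto_const_nhds h2 (fun _ => zero_le)
        fun n => eLpNorm_mono fun x => ?_
      exact PiLp.norm_apply_le (gradient (φ n) x - G x) i)
  refine tendsto_nhds_unique t1 (t2.neg.congr fun n => ?_)
  simp only [gradient_apply_eq] at hφ2 ⊢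
  exact (integral_mul_fderiv_eq_neg_fderiv_mul_of_integrable ((hφ2 n).integrable_mul hf2)
    ((memLp_testFunction (φ n)).integrable_mul hdf2)
    ((memLp_testFunction (φ n)).integrable_mul hf2)
    (fun x _ => ((φ n).contDiff.differentiable (by simp)) x)
    (fun x _ => (hf.differentiable (by simp)) x)).symm

theorem IsTestLimit.hasWeakGradient {w : EuclideanSpace ℝ (Fin N) → ℝ}
    {G : EuclideanSpace ℝ (Fin N) → EuclideanSpace ℝ (Fin N)} (h : IsTestLimit Ω w G)
    (Ω' : Opens (EuclideanSpace ℝ (Fin N))) : HasWeakGradient Ω' w G := by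
  refine ⟨(h.memLp.locallyIntegrable (by norm_num)).locallyIntegrableOn _,
    (h.memLp_grad.locallyIntegrable (by norm_num)).locallyIntegrableOn _, fun φ i => ?_⟩
  rw [setIntegral_eq_integral_of_forall_compl_eq_zero,
    setIntegral_eq_integral_of_forall_compl_eq_zero]
  · exact h.integral_mul_fderiv φ.contDiff φ.hasCompactSupport i
  · intro x hx
    rw [image_eq_zero_of_notMem_tsupport fun h => hx (φ.tsupport_subset h), mul_zero]
  · intro x hx
    rw [fderiv_of_notMem_tsupport ℝ fun h => hx (φ.tsupport_subset h)]
    simp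

/-- Every approximant vanishes off `Ω`, so the norm of `w` there is below every `ε`. -/
theorem IsTestLimit.ae_eq_zero {w : EuclideanSpace ℝ (Fin N) → ℝ}
    {G : EuclideanSpace ℝ (Fin N) → EuclideanSpace ℝ (Fin N)} (h : IsTestLimit Ω w G) :
    ∀ᵐ x ∂(volume.restrict ((Ω : Set (EuclideanSpace ℝ (Fin N)))ᶜ)), w x = 0 := by
  have hle : ∀ ε : ℝ≥0∞, ε ≠ 0 →
      eLpNorm w 2 (volume.restrict ((Ω : Set (EuclideanSpace ℝ (Fin N)))ᶜ)) ≤ ε := by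
    intro ε hε
    obtain ⟨φ, h1, -⟩ := h.exists_le ε hε
    refine le_trans ?_ h1
    refine le_of_eq_of_le (eLpNorm_congr_norm_ae ?_)
      (eLpNorm_mono_measure _ Measure.restrict_le_self)
    refine (ae_restrict_iff' Ω.isOpen.measurableSet.compl).2 (.of_forall fun x hx => ?_)
    rw [image_eq_zero_of_notMem_tsupport fun h => hx (φ.tsupport_subset h), zero_sub, norm_neg]
  have h0 : eLpNorm w 2 (volume.restrict ((Ω : Set (EuclideanSpace ℝ (Fin N)))ᶜ)) = 0 := by
    by_contra hne
    have := hle _ (ENNReal.half_pos hne).ne'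
    exact absurd this (not_le.2 (ENNReal.half_lt_self hne
      ((eLpNorm_mono_measure _ Measure.restrict_le_self).trans_lt h.memLp.2).ne))
  exact (eLpNorm_eq_zero_iff h.memLp.1.restrict (by norm_num)).1 h0

theorem IsTestLimit.weakGradient_ae_eq {w : EuclideanSpace ℝ (Fin N) → ℝ}
    {G : EuclideanSpace ℝ (Fin N) → EuclideanSpace ℝ (Fin N)} (h : IsTestLimit Ω w G) :
    weakGradient Ω w =ᵐ[volume.restrict (Ω : Set (EuclideanSpace ℝ (Fin N)))] G :=
  (h.hasWeakGradient Ω).weakGradient_ae_eq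

theorem IsTestLimit.memX {w : EuclideanSpace ℝ (Fin N) → ℝ}
    {G : EuclideanSpace ℝ (Fin N) → EuclideanSpace ℝ (Fin N)} (h : IsTestLimit Ω w G) :
    MemX Ω w := by
  have hH1 : ∀ Ω' : Opens (EuclideanSpace ℝ (Fin N)), MemH1 Ω' w := fun Ω' =>
    ⟨h.memLp.restrict _, G, h.hasWeakGradient Ω', h.memLp_grad.restrict _⟩
  obtain ⟨φ, h1, h2⟩ := h.exists_seq
  refine ⟨hH1 ⊤, ⟨hH1 Ω, φ, ?_, ?_⟩, h.ae_eq_zero⟩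
  · exact tendsto_of_tendsto_of_tendsto_of_le_of_le tendsto_const_nhds h1 (fun _ => zero_le)
      fun n => eLpNorm_mono_measure _ Measure.restrict_le_self
  · refine tendsto_of_tendsto_of_tendsto_of_le_of_le tendsto_const_nhds h2 (fun _ => zero_le)
      fun n => le_of_eq_of_le (eLpNorm_congr_ae ?_)
        (eLpNorm_mono_measure _ Measure.restrict_le_self)
    filter_upwards [h.weakGradient_ae_eq] with x hx
    rw [hx]

/-! ### Chain rule. -/

theorem gradient_comp {F : ℝ → ℝ} (hF : Differentiable ℝ F)
    {f : EuclideanSpace ℝ (Fin N) → ℝ} (hf : Differentiable ℝ f) (x : EuclideanSpace ℝ (Fin N)) :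
    gradient (fun y => F (f y)) x = deriv F (f x) • gradient f x := by
  have : fderiv ℝ (fun y => F (f y)) x = deriv F (f x) • fderiv ℝ f x :=
    ((hF (f x)).hasDerivAt.comp_hasFDerivAt x (hf x).hasFDerivAt).fderiv
  rw [gradient, this, map_smul, gradient]

/-- The chain rule in `H¹₀`. -/
theorem IsTestLimit.comp {w : EuclideanSpace ℝ (Fin N) → ℝ}
    {G : EuclideanSpace ℝ (Fin N) → EuclideanSpace ℝ (Fin N)} (h : IsTestLimit Ω w G)
    {F : ℝ → ℝ} (hF : ContDiff ℝ ∞ F) (hF0 : F 0 = 0) (hF' : ∀ t, |deriv F t| ≤ 1) :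
    IsTestLimit Ω (fun x => F (w x)) (fun x => deriv F (w x) • G x) := by
  have hFd : Differentiable ℝ F := hF.differentiable (by simp)
  have hdc : Continuous (deriv F) := hF.continuous_deriv (by simp)
  have hlip : ∀ a b, ‖F a - F b‖ ≤ ‖a - b‖ := fun a b => by
    simpa using (Convex.norm_image_sub_le_of_norm_deriv_le (f := F) (C := 1) (s := Set.univ)
      (fun x _ => hFd x) (fun x _ => hF' x) convex_univ (Set.mem_univ b) (Set.mem_univ a))
  have hdw : AEStronglyMeasurable (fun x => deriv F (w x)) volume :=
    hdc.comp_aestronglyMeasurable h.memLp.1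
  have hdG : ∀ t (v : EuclideanSpace ℝ (Fin N)), ‖deriv F t • v‖ ≤ ‖v‖ := fun t v => by
    rw [norm_smul]
    exact mul_le_of_le_one_left (norm_nonneg _) (hF' t)
  have hw2 : MemLp (fun x => F (w x)) 2 volume :=
    h.memLp.of_le (hF.continuous.comp_aestronglyMeasurable h.memLp.1)
      (.of_forall fun x => by simpa [hF0] using hlip (w x) 0)
  have hG2 : MemLp (fun x => deriv F (w x) • G x) 2 volume :=
    h.memLp_grad.of_le (hdw.smul h.memLp_grad.1) (.of_forall fun x => hdG _ _)
  obtain ⟨φ, h1, h2⟩ := h.exists_seq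
  -- `deriv F` is merely continuous, so convergence of `deriv F (φ n)` is obtained pointwise a.e.
  -- along a subsequence and used through dominated convergence.
  obtain ⟨ns, hns, hae⟩ := (tendstoInMeasure_of_tendsto_eLpNorm (by norm_num)
    (fun n => (memLp_testFunction (φ n)).1) h.memLp.1 h1).exists_seq_tendsto_ae
  let ψ : ℕ → 𝓓(Ω, ℝ) := fun n =>
    ⟨fun x => F (φ (ns n) x), hF.comp (φ (ns n)).contDiff,
      (φ (ns n)).hasCompactSupport.comp_left hF0,
      (tsupport_comp_subset hF0 _).trans (φ (ns n)).tsupport_subset⟩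
  have hψg : ∀ n x, gradient (ψ n) x = deriv F (φ (ns n) x) • gradient (φ (ns n)) x := fun n x =>
    gradient_comp hFd ((φ (ns n)).contDiff.differentiable (by simp)) x
  refine isTestLimit_of_tendsto hw2 hG2 ψ ?_ ?_
  · refine tendsto_of_tendsto_of_tendsto_of_le_of_le tendsto_const_nhds
      (h1.comp hns.tendsto_atTop) (fun _ => zero_le) fun n => eLpNorm_mono fun x => ?_
    exact hlip _ _
  · have hms : ∀ n, AEStronglyMeasurable (fun x => (deriv F (φ (ns n) x) - deriv F (w x)) • G x)
        volume := fun n =>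
      ((hdc.comp (φ (ns n)).continuous).aestronglyMeasurable.sub hdw).smul h.memLp_grad.1
    have t2 : Tendsto (fun n => eLpNorm
        (fun x => (deriv F (φ (ns n) x) - deriv F (w x)) • G x) 2 volume) atTop (𝓝 0) := by
      refine tendsto_eLpNorm_two_zero_of_dominated (g := fun x => (2 : ℝ) • G x) hms
        (h.memLp_grad.const_smul (2 : ℝ)) (fun n => .of_forall fun x => ?_) ?_
      · rw [norm_smul, norm_smul]
        refine mul_le_mul_of_nonneg_right ?_ (norm_nonneg _)
        rw [Real.norm_eq_abs, Real.norm_eq_abs, abs_two]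
        linarith [abs_sub (deriv F (φ (ns n) x)) (deriv F (w x)), hF' (φ (ns n) x), hF' (w x)]
      · filter_upwards [hae] with x hx
        have := (((hdc.tendsto (w x)).comp hx).sub_const (deriv F (w x))).smul_const (G x)
        simpa using this
    have t3 := (h2.comp hns.tendsto_atTop).add t2
    rw [add_zero] at t3
    refine tendsto_of_tendsto_of_tendsto_of_le_of_le tendsto_const_nhds t3
      (fun _ => zero_le) fun n => ?_
    -- The error splits into `F'(φ) (∇φ - G)`, controlled by `|F'| ≤ 1`, and `(F'(φ) - F'(w)) G`,
    -- dominated by `2 |G|`.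
    have hd : (fun x => gradient (ψ n) x - deriv F (w x) • G x)
        = (fun x => deriv F (φ (ns n) x) • (gradient (φ (ns n)) x - G x))
          + fun x => (deriv F (φ (ns n) x) - deriv F (w x)) • G x := by
      ext1 x
      simp only [Pi.add_apply, hψg, smul_sub, sub_smul]
      abel
    rw [hd]
    refine (eLpNorm_add_le ((hdc.comp (φ (ns n)).continuous).aestronglyMeasurable.smul
      ((memLp_gradient (φ (ns n))).1.sub h.memLp_grad.1)) (hms n) (by norm_num)).trans ?_
    exact add_le_add_left (eLpNorm_mono fun x => hdG _ _) _

/-! ### The negative part. -/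

/-- A smooth approximation of `t ↦ max (-t) 0`. -/
def smoothNegPart (ε t : ℝ) : ℝ := (√(t ^ 2 + ε ^ 2) - ε - t) / 2

/-- The pointwise limit of the derivatives of `smoothNegPart ε` as `ε → 0`. -/
def negPartSlope (t : ℝ) : ℝ := (t / |t| - 1) / 2

theorem hasDerivAt_smoothNegPart {ε : ℝ} (hε : 0 < ε) (t : ℝ) :
    HasDerivAt (smoothNegPart ε) ((t / √(t ^ 2 + ε ^ 2) - 1) / 2) t := by
  have hpos : t ^ 2 + ε ^ 2 ≠ 0 := by positivity
  have h1 : HasDerivAt (fun t => t ^ 2 + ε ^ 2) (2 * t) t := by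
    simpa using (hasDerivAt_pow 2 t).add_const (ε ^ 2)
  have h2 := (((h1.sqrt hpos).sub_const ε).sub (hasDerivAt_id t)).div_const 2
  refine h2.congr_deriv ?_
  rw [mul_div_mul_left _ _ two_ne_zero]

theorem contDiff_smoothNegPart {ε : ℝ} (hε : 0 < ε) : ContDiff ℝ ∞ (smoothNegPart ε) := by
  have h : ContDiff ℝ ∞ fun t : ℝ => √(t ^ 2 + ε ^ 2) :=
    ContDiff.sqrt (by fun_prop) fun t => by positivity
  exact ((h.sub contDiff_const).sub contDiff_id).div_const 2

theorem abs_slope_le_one {a b : ℝ} (h : |a| ≤ b) : |(a / b - 1) / 2| ≤ 1 := by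
  have hb : 0 ≤ b := (abs_nonneg a).trans h
  have h1 : |a / b| ≤ 1 := by
    rw [abs_div, abs_of_nonneg hb]
    exact div_le_one_of_le₀ h hb
  rw [abs_le] at h1 ⊢
  constructor <;> linarith

theorem abs_le_sqrt_sq_add_sq (ε t : ℝ) : |t| ≤ √(t ^ 2 + ε ^ 2) :=
  Real.abs_le_sqrt (by linarith [sq_nonneg ε])

theorem abs_deriv_smoothNegPart_le {ε : ℝ} (hε : 0 < ε) (t : ℝ) :
    |deriv (smoothNegPart ε) t| ≤ 1 := by
  rw [(hasDerivAt_smoothNegPart hε t).deriv]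
  exact abs_slope_le_one (abs_le_sqrt_sq_add_sq ε t)

/-- The shift by `-ε` in `smoothNegPart` serves this normalisation, which keeps the composition with
a test function supported in `Ω`. -/
theorem smoothNegPart_zero {ε : ℝ} (hε : 0 < ε) : smoothNegPart ε 0 = 0 := by
  simp [smoothNegPart, Real.sqrt_sq hε.le]

theorem max_neg_zero_eq (t : ℝ) : max (-t) 0 = (|t| - t) / 2 := by
  rcases le_total 0 t with h | h
  · rw [abs_of_nonneg h, max_eq_right (by linarith)]; ring
  · rw [abs_of_nonpos h, max_eq_left (by linarith)]; ring

/-- A majorant independent of `ε`, from `ε ≤ √(t² + ε²) ≤ |t| + ε`. -/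
theorem abs_smoothNegPart_sub_le {ε : ℝ} (hε : 0 < ε) (t : ℝ) :
    |smoothNegPart ε t - max (-t) 0| ≤ |t| := by
  have h1 := abs_le_sqrt_sq_add_sq ε t
  have h2 : √(t ^ 2 + ε ^ 2) ≤ |t| + ε := by
    refine Real.sqrt_le_iff.2 ⟨by positivity, ?_⟩
    nlinarith [sq_abs t, mul_nonneg (abs_nonneg t) hε.le]
  have h3 : ε ≤ √(t ^ 2 + ε ^ 2) := Real.le_sqrt_of_sq_le (by linarith [sq_nonneg t])
  rw [max_neg_zero_eq, smoothNegPart, abs_le]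
  constructor <;> linarith [abs_nonneg t]

theorem tendsto_sqrt_sq_add_sq (t : ℝ) {ε : ℕ → ℝ} (hε : Tendsto ε atTop (𝓝 0)) :
    Tendsto (fun n => √(t ^ 2 + ε n ^ 2)) atTop (𝓝 |t|) := by
  have h := ((hε.pow 2).const_add (t ^ 2)).sqrt
  simpa [Real.sqrt_sq_eq_abs] using h

theorem tendsto_smoothNegPart (t : ℝ) {ε : ℕ → ℝ} (hε : Tendsto ε atTop (𝓝 0)) :
    Tendsto (fun n => smoothNegPart (ε n) t) atTop (𝓝 (max (-t) 0)) := by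
  rw [max_neg_zero_eq]
  simpa [smoothNegPart] using (((tendsto_sqrt_sq_add_sq t hε).sub hε).sub_const t).div_const 2

/-- At `t = 0` every derivative is `-1/2`, which is also `negPartSlope 0` because `0 / 0 = 0`. -/
theorem tendsto_deriv_smoothNegPart (t : ℝ) {ε : ℕ → ℝ} (hpos : ∀ n, 0 < ε n)
    (hε : Tendsto ε atTop (𝓝 0)) :
    Tendsto (fun n => deriv (smoothNegPart (ε n)) t) atTop (𝓝 (negPartSlope t)) := by
  simp only [(hasDerivAt_smoothNegPart (hpos _) t).deriv]
  rcases eq_or_ne t 0 with rfl | ht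
  · simp [negPartSlope]
  · exact ((tendsto_const_nhds.div (tendsto_sqrt_sq_add_sq t hε)
      (abs_ne_zero.2 ht)).sub_const 1).div_const 2

theorem abs_negPartSlope_le (t : ℝ) : |negPartSlope t| ≤ 1 := abs_slope_le_one le_rfl

theorem negPartSlope_nonpos (t : ℝ) : negPartSlope t ≤ 0 := by
  have : t / |t| ≤ 1 := div_le_one_of_le₀ (le_abs_self t) (abs_nonneg t)
  rw [negPartSlope]
  linarith

theorem measurable_negPartSlope : Measurable negPartSlope := by
  unfold negPartSlope
  fun_prop

/-- The negative part stays in `H¹₀`. -/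
theorem IsTestLimit.negPart {u : EuclideanSpace ℝ (Fin N) → ℝ}
    {G : EuclideanSpace ℝ (Fin N) → EuclideanSpace ℝ (Fin N)} (h : IsTestLimit Ω u G) :
    IsTestLimit Ω (fun x => max (-u x) 0) (fun x => negPartSlope (u x) • G x) := by
  have hpos : ∀ n : ℕ, (0 : ℝ) < 1 / ((n : ℝ) + 1) := fun n => by positivity
  have hε := tendsto_one_div_add_atTop_nhds_zero_nat (𝕜 := ℝ)
  have hn := fun n : ℕ => h.comp (contDiff_smoothNegPart (hpos n)) (smoothNegPart_zero (hpos n))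
    (abs_deriv_smoothNegPart_le (hpos n))
  have hu2 : MemLp (fun x => max (-u x) 0) 2 volume :=
    h.memLp.of_le (h.memLp.1.neg.sup aestronglyMeasurable_const) (.of_forall fun x => by
      rw [Real.norm_eq_abs, Real.norm_eq_abs, abs_of_nonneg (le_max_right _ _)]
      exact max_le (neg_le_abs _) (abs_nonneg _))
  have hG2 : MemLp (fun x => negPartSlope (u x) • G x) 2 volume :=
    h.memLp_grad.of_le
      ((measurable_negPartSlope.comp_aemeasurable
        h.memLp.1.aemeasurable).aestronglyMeasurable.smul h.memLp_grad.1)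
      (.of_forall fun x => by
        rw [norm_smul]
        exact mul_le_of_le_one_left (norm_nonneg _) (abs_negPartSlope_le _))
  refine IsTestLimit.of_tendsto hn hu2 hG2 ?_ ?_
  · refine tendsto_eLpNorm_two_zero_of_dominated (fun n => (hn n).memLp.1.sub hu2.1) h.memLp
      (fun n => .of_forall fun x => abs_smoothNegPart_sub_le (hpos n) (u x))
      (.of_forall fun x => ?_)
    simpa using (tendsto_smoothNegPart (u x) hε).sub_const (max (-u x) 0)
  · refine tendsto_eLpNorm_two_zero_of_dominated (g := (2 : ℝ) • G)
      (fun n => (hn n).memLp_grad.1.sub hG2.1)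
      (h.memLp_grad.const_smul (2 : ℝ)) (fun n => .of_forall fun x => ?_)
      (.of_forall fun x => ?_)
    · rw [Pi.sub_apply, ← sub_smul, norm_smul, Pi.smul_apply, norm_smul]
      refine mul_le_mul_of_nonneg_right ?_ (norm_nonneg _)
      rw [Real.norm_eq_abs, Real.norm_eq_abs, abs_two]
      linarith [abs_sub (deriv (smoothNegPart (1 / ((n : ℝ) + 1))) (u x)) (negPartSlope (u x)),
        abs_deriv_smoothNegPart_le (hpos n) (u x), abs_negPartSlope_le (u x)]
    · have := ((tendsto_deriv_smoothNegPart (u x) hpos hε).sub_const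
        (negPartSlope (u x))).smul_const (G x)
      simpa [sub_smul] using this

/-! ### Hardy's inequality. -/

theorem integral_norm_sq_eq_toReal_eLpNorm_sq {α F : Type*} [MeasurableSpace α] {ν : Measure α}
    [NormedAddCommGroup F] {f : α → F} (hf : MemLp f 2 ν) :
    ∫ x, ‖f x‖ ^ 2 ∂ν = (eLpNorm f 2 ν).toReal ^ 2 := by
  have h0 : 0 ≤ ∫ x, ‖f x‖ ^ 2 ∂ν := integral_nonneg fun x => by positivity
  rw [hf.eLpNorm_eq_integral_rpow_norm (by norm_num) (by norm_num)]
  simp only [ENNReal.toReal_ofNat, Real.rpow_ofNat]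
  rw [ENNReal.toReal_ofReal (by positivity), ← Real.rpow_natCast, ← Real.rpow_mul h0]
  norm_num

theorem eLpNorm_two_le_iff {α F F' : Type*} [MeasurableSpace α] {ν : Measure α}
    [NormedAddCommGroup F] [NormedAddCommGroup F'] {f : α → F} {g : α → F'} (hf : MemLp f 2 ν)
    (hg : MemLp g 2 ν) :
    eLpNorm f 2 ν ≤ eLpNorm g 2 ν ↔ ∫ x, ‖f x‖ ^ 2 ∂ν ≤ ∫ x, ‖g x‖ ^ 2 ∂ν := by
  rw [integral_norm_sq_eq_toReal_eLpNorm_sq hf, integral_norm_sq_eq_toReal_eLpNorm_sq hg,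
    pow_le_pow_iff_left₀ ENNReal.toReal_nonneg ENNReal.toReal_nonneg two_ne_zero,
    ENNReal.toReal_le_toReal hf.2.ne hg.2.ne]

theorem hasFDerivAt_inv_norm_sq_add {δ : ℝ} (hδ : 0 < δ) (x : EuclideanSpace ℝ (Fin N)) :
    HasFDerivAt (fun y : EuclideanSpace ℝ (Fin N) => (‖y‖ ^ 2 + δ)⁻¹)
      (-((‖x‖ ^ 2 + δ) ^ 2)⁻¹ • (2 • innerSL ℝ x)) x := by
  have h1 : HasFDerivAt (fun y : EuclideanSpace ℝ (Fin N) => ‖y‖ ^ 2 + δ) (2 • innerSL ℝ x) x :=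
    (hasStrictFDerivAt_norm_sq x).hasFDerivAt.add_const δ
  exact (hasDerivAt_inv (by positivity)).comp_hasFDerivAt x h1

theorem fderiv_coord_mul_inv {δ : ℝ} (hδ : 0 < δ) (x : EuclideanSpace ℝ (Fin N)) (i : Fin N) :
    fderiv ℝ (fun y : EuclideanSpace ℝ (Fin N) => y i * (‖y‖ ^ 2 + δ)⁻¹) x
      (EuclideanSpace.single i 1)
      = (‖x‖ ^ 2 + δ)⁻¹ - 2 * x i ^ 2 * ((‖x‖ ^ 2 + δ)⁻¹) ^ 2 := by
  have h := ((EuclideanSpace.proj (𝕜 := ℝ) i).hasFDerivAt (x := x)).mul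
    (hasFDerivAt_inv_norm_sq_add hδ x)
  have h' : HasFDerivAt (fun y : EuclideanSpace ℝ (Fin N) => y i * (‖y‖ ^ 2 + δ)⁻¹) _ x := h
  rw [h'.fderiv]
  simp [EuclideanSpace.inner_single_right]
  ring

theorem differentiable_coord_mul_inv {δ : ℝ} (hδ : 0 < δ) (i : Fin N) :
    Differentiable ℝ (fun y : EuclideanSpace ℝ (Fin N) => y i * (‖y‖ ^ 2 + δ)⁻¹) := fun x =>
  (((EuclideanSpace.proj (𝕜 := ℝ) i).hasFDerivAt (x := x)).mul
    (hasFDerivAt_inv_norm_sq_add hδ x)).differentiableAt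

theorem continuous_inv_norm_sq_add {δ : ℝ} (hδ : 0 < δ) :
    Continuous fun y : EuclideanSpace ℝ (Fin N) => (‖y‖ ^ 2 + δ)⁻¹ :=
  (by fun_prop : Continuous fun y : EuclideanSpace ℝ (Fin N) => ‖y‖ ^ 2 + δ).inv₀
    fun y => by positivity

/-- The divergence theorem for the field `f² x / (|x|² + δ)`. -/
theorem integral_sq_mul_div_eq {f : EuclideanSpace ℝ (Fin N) → ℝ} (hf : ContDiff ℝ ∞ f)
    (hfc : HasCompactSupport f) {δ : ℝ} (hδ : 0 < δ) :
    ∫ x, f x ^ 2 * (N * (‖x‖ ^ 2 + δ)⁻¹ - 2 * ‖x‖ ^ 2 * ((‖x‖ ^ 2 + δ)⁻¹) ^ 2)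
      = - ∫ x, 2 * f x * (‖x‖ ^ 2 + δ)⁻¹ * inner ℝ x (gradient f x) := by
  have hg := continuous_inv_norm_sq_add (N := N) hδ
  have hfd : Differentiable ℝ f := hf.differentiable (by simp)
  have hsq : ∀ x (i : Fin N), fderiv ℝ (fun y => f y ^ 2) x (EuclideanSpace.single i 1)
      = 2 * f x * gradient f x i := fun x i => by
    rw [((hfd x).hasFDerivAt.pow 2).fderiv, gradient_apply_eq]
    simp
  have hint : ∀ k : EuclideanSpace ℝ (Fin N) → ℝ, Continuous k →
      Integrable (fun x => f x * k x) volume := fun k hk =>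
    (hf.continuous.mul hk).integrable_of_hasCompactSupport hfc.mul_right
  have hgc : ∀ i : Fin N, Continuous fun x => gradient f x i := fun i =>
    (EuclideanSpace.proj (𝕜 := ℝ) i).continuous.comp (continuous_gradient hf)
  have hxc : ∀ i : Fin N, Continuous fun x : EuclideanSpace ℝ (Fin N) => x i := fun i =>
    (EuclideanSpace.proj (𝕜 := ℝ) i).continuous
  have i1 : ∀ i : Fin N, Integrable (fun x =>
      f x ^ 2 * ((‖x‖ ^ 2 + δ)⁻¹ - 2 * x i ^ 2 * ((‖x‖ ^ 2 + δ)⁻¹) ^ 2)) volume := fun i => by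
    have hk : Continuous fun x : EuclideanSpace ℝ (Fin N) =>
        f x * ((‖x‖ ^ 2 + δ)⁻¹ - 2 * x i ^ 2 * ((‖x‖ ^ 2 + δ)⁻¹) ^ 2) :=
      hf.continuous.mul (hg.sub (((hxc i).pow 2).const_mul 2 |>.mul (hg.pow 2)))
    refine (hint _ hk).congr (.of_forall fun x => ?_)
    ring
  have i2 : ∀ i : Fin N, Integrable (fun x =>
      2 * f x * gradient f x i * (x i * (‖x‖ ^ 2 + δ)⁻¹)) volume := fun i => by
    have hk : Continuous fun x => 2 * gradient f x i * (x i * (‖x‖ ^ 2 + δ)⁻¹) :=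
      ((hgc i).const_mul 2).mul ((hxc i).mul hg)
    refine (hint _ hk).congr (.of_forall fun x => ?_)
    ring
  have i3 : ∀ i : Fin N, Integrable (fun x => f x ^ 2 * (x i * (‖x‖ ^ 2 + δ)⁻¹)) volume :=
    fun i => by
    have hk : Continuous fun x => f x * (x i * (‖x‖ ^ 2 + δ)⁻¹) :=
      hf.continuous.mul ((hxc i).mul hg)
    refine (hint _ hk).congr (.of_forall fun x => ?_)
    ring
  have hi : ∀ i : Fin N,
      ∫ x, f x ^ 2 * ((‖x‖ ^ 2 + δ)⁻¹ - 2 * x i ^ 2 * ((‖x‖ ^ 2 + δ)⁻¹) ^ 2)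
        = - ∫ x, 2 * f x * gradient f x i * (x i * (‖x‖ ^ 2 + δ)⁻¹) := fun i => by
    have := integral_mul_fderiv_eq_neg_fderiv_mul_of_integrable (μ := volume) (𝕜 := ℝ)
      (f := fun x => f x ^ 2)
      (g := fun y : EuclideanSpace ℝ (Fin N) => y i * (‖y‖ ^ 2 + δ)⁻¹)
      (v := EuclideanSpace.single i 1) (by simpa only [hsq] using i2 i)
      (by simpa only [fderiv_coord_mul_inv hδ] using i1 i) (i3 i)
      (fun x _ => (hfd x).pow 2) (fun x _ => differentiable_coord_mul_inv hδ i x)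
    simpa only [hsq, fderiv_coord_mul_inv hδ] using this
  -- Summing over the coordinates assembles the divergence: `∑ xᵢ² = |x|²`, and the `N` copies of
  -- `(|x|² + δ)⁻¹` add up.
  have hsum := Finset.sum_congr rfl fun i (_ : i ∈ (Finset.univ : Finset (Fin N))) => hi i
  rw [Finset.sum_neg_distrib, ← integral_finsetSum _ fun i _ => i1 i,
    ← integral_finsetSum _ fun i _ => i2 i] at hsum
  have e1 : ∀ x : EuclideanSpace ℝ (Fin N),
      ∑ i, f x ^ 2 * ((‖x‖ ^ 2 + δ)⁻¹ - 2 * x i ^ 2 * ((‖x‖ ^ 2 + δ)⁻¹) ^ 2)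
        = f x ^ 2 * (N * (‖x‖ ^ 2 + δ)⁻¹ - 2 * ‖x‖ ^ 2 * ((‖x‖ ^ 2 + δ)⁻¹) ^ 2) := fun x => by
    generalize (‖x‖ ^ 2 + δ)⁻¹ = g
    rw [← Finset.mul_sum, Finset.sum_sub_distrib, ← Finset.sum_mul, ← Finset.mul_sum,
      EuclideanSpace.norm_sq_eq]
    simp
  have e2 : ∀ x : EuclideanSpace ℝ (Fin N),
      ∑ i, 2 * f x * gradient f x i * (x i * (‖x‖ ^ 2 + δ)⁻¹)
        = 2 * f x * (‖x‖ ^ 2 + δ)⁻¹ * inner ℝ x (gradient f x) := fun x => by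
    rw [PiLp.inner_apply, Finset.mul_sum]
    refine Finset.sum_congr rfl fun i _ => ?_
    simp only [RCLike.inner_apply, conj_trivial]
    ring
  simpa only [e1, e2] using hsum

/-- Expand `0 ≤ |v + a c g x|²` with `g = (|x|² + δ)⁻¹`. The two sides differ by this square plus `a
c² (2a + 2) (g - |x|² g²)`, nonnegative because `|x|² g ≤ 1`. In the application `c` and `v` are the
value and gradient of `f`, and `2a + 2 = N`. -/
theorem hardy_pointwise {a δ : ℝ} (ha : 0 ≤ a) (hδ : 0 < δ) (c : ℝ)
    (x v : EuclideanSpace ℝ (Fin N)) :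
    ‖a * (‖x‖ / (‖x‖ ^ 2 + δ)) * c‖ ^ 2 ≤ ‖v‖ ^ 2
      + a * (2 * c * (‖x‖ ^ 2 + δ)⁻¹ * inner ℝ x v)
      + a * (c ^ 2 *
        ((2 * a + 2) * (‖x‖ ^ 2 + δ)⁻¹ - 2 * ‖x‖ ^ 2 * ((‖x‖ ^ 2 + δ)⁻¹) ^ 2)) := by
  have hsq := sq_nonneg ‖v + (a * c * (‖x‖ ^ 2 + δ)⁻¹) • x‖
  rw [norm_add_sq_real, inner_smul_right, norm_smul, real_inner_comm, mul_pow,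
    Real.norm_eq_abs, sq_abs] at hsq
  rw [Real.norm_eq_abs, sq_abs, div_eq_mul_inv]
  have hgp : 0 < (‖x‖ ^ 2 + δ)⁻¹ := by positivity
  have hg1 : ‖x‖ ^ 2 * (‖x‖ ^ 2 + δ)⁻¹ ≤ 1 := by
    rw [← div_eq_mul_inv]
    exact div_le_one_of_le₀ (by linarith) (by positivity)
  generalize (‖x‖ ^ 2 + δ)⁻¹ = g at *
  have hgg : 0 ≤ g - ‖x‖ ^ 2 * g ^ 2 := by
    have := mul_nonneg hgp.le (sub_nonneg.2 hg1)
    linarith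
  have hN' : 0 ≤ a * (c ^ 2 * ((2 * a + 2) * (g - ‖x‖ ^ 2 * g ^ 2))) := by positivity
  linarith

/-- A regularised Hardy inequality for test functions. -/
theorem integral_hardy_le (hN : 2 ≤ N) {f : EuclideanSpace ℝ (Fin N) → ℝ}
    (hf : ContDiff ℝ ∞ f) (hfc : HasCompactSupport f) {δ : ℝ} (hδ : 0 < δ) :
    ∫ x, ‖((N : ℝ) - 2) / 2 * (‖x‖ / (‖x‖ ^ 2 + δ)) * f x‖ ^ 2 ≤ ∫ x, ‖gradient f x‖ ^ 2 := by
  have hg := continuous_inv_norm_sq_add (N := N) hδ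
  have hgr := continuous_gradient hf
  have hint : ∀ k : EuclideanSpace ℝ (Fin N) → ℝ, Continuous k →
      Integrable (fun x => f x * k x) volume := fun k hk =>
    (hf.continuous.mul hk).integrable_of_hasCompactSupport hfc.mul_right
  set a : ℝ := ((N : ℝ) - 2) / 2 with ha
  have ha0 : 0 ≤ a := by
    have : (2 : ℝ) ≤ N := by exact_mod_cast hN
    rw [ha]; linarith
  have j1 : Integrable (fun x => ‖gradient f x‖ ^ 2) volume :=
    (hgr.norm.pow 2).integrable_of_hasCompactSupport
      (HasCompactSupport.intro hfc fun x hx => by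
        simp [gradient_eq_zero_of_notMem_tsupport hx])
  have j2 : Integrable
      (fun x => 2 * f x * (‖x‖ ^ 2 + δ)⁻¹ * inner ℝ x (gradient f x)) volume := by
    have hk : Continuous fun x => 2 * (‖x‖ ^ 2 + δ)⁻¹ * inner ℝ x (gradient f x) :=
      (hg.const_mul 2).mul (continuous_id.inner hgr)
    refine (hint _ hk).congr (.of_forall fun x => ?_)
    ring
  have j3 : Integrable (fun x => f x ^ 2 *
      (N * (‖x‖ ^ 2 + δ)⁻¹ - 2 * ‖x‖ ^ 2 * ((‖x‖ ^ 2 + δ)⁻¹) ^ 2)) volume := by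
    have hk : Continuous fun x : EuclideanSpace ℝ (Fin N) =>
        f x * (N * (‖x‖ ^ 2 + δ)⁻¹ - 2 * ‖x‖ ^ 2 * ((‖x‖ ^ 2 + δ)⁻¹) ^ 2) :=
      hf.continuous.mul ((hg.const_mul _).sub (((continuous_norm.pow 2).const_mul 2).mul
        (hg.pow 2)))
    refine (hint _ hk).congr (.of_forall fun x => ?_)
    ring
  have j4 : Integrable (fun x => ‖a * (‖x‖ / (‖x‖ ^ 2 + δ)) * f x‖ ^ 2) volume := by
    have hk : Continuous fun x : EuclideanSpace ℝ (Fin N) =>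
        f x * (a * (‖x‖ * (‖x‖ ^ 2 + δ)⁻¹)) ^ 2 :=
      hf.continuous.mul (((continuous_norm.mul hg).const_mul a).pow 2)
    refine (hint _ hk).congr (.of_forall fun x => ?_)
    simp only [Real.norm_eq_abs, sq_abs, div_eq_mul_inv]
    ring
  have hdiv := integral_sq_mul_div_eq hf hfc hδ
  have hNa : (N : ℝ) = 2 * a + 2 := by rw [ha]; ring
  have hpt : ∀ x, ‖a * (‖x‖ / (‖x‖ ^ 2 + δ)) * f x‖ ^ 2 ≤ ‖gradient f x‖ ^ 2
      + a * (2 * f x * (‖x‖ ^ 2 + δ)⁻¹ * inner ℝ x (gradient f x))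
      + a * (f x ^ 2 * (N * (‖x‖ ^ 2 + δ)⁻¹ - 2 * ‖x‖ ^ 2 * ((‖x‖ ^ 2 + δ)⁻¹) ^ 2)) :=
    fun x => hNa ▸ hardy_pointwise ha0 hδ (f x) x (gradient f x)
  -- After integration the last two terms cancel by the divergence identity `hdiv`.
  have hle := integral_mono j4 ((j1.add (j2.const_mul a)).add (j3.const_mul a)) hpt
  rw [integral_add' (j1.add (j2.const_mul a)) (j3.const_mul a),
    integral_add' j1 (j2.const_mul a), integral_const_mul, integral_const_mul, hdiv] at hle
  linarith

/-- For fixed `δ` the weight is bounded, as `r ≤ (1 + δ⁻¹) (r² + δ)`. The bound degenerates as `δ →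
0`; it serves only to pass from test functions to `w` at fixed `δ`. -/
theorem memLp_hardy_weight_mul {w : EuclideanSpace ℝ (Fin N) → ℝ} (hw : MemLp w 2 volume)
    {δ : ℝ} (hδ : 0 < δ) (a : ℝ) :
    MemLp (fun x => a * (‖x‖ / (‖x‖ ^ 2 + δ)) * w x) 2 volume ∧
    eLpNorm (fun x => a * (‖x‖ / (‖x‖ ^ 2 + δ)) * w x) 2 volume
      ≤ ENNReal.ofReal (|a| * (1 + δ⁻¹)) * eLpNorm w 2 volume := by
  have hc : Continuous fun x : EuclideanSpace ℝ (Fin N) => a * (‖x‖ / (‖x‖ ^ 2 + δ)) :=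
    (continuous_norm.div (by fun_prop) fun x => by positivity).const_mul a
  have hle : ∀ᵐ x ∂volume, ‖a * (‖x‖ / (‖x‖ ^ 2 + δ)) * w x‖ ≤ |a| * (1 + δ⁻¹) * ‖w x‖ := by
    refine .of_forall fun x => ?_
    rw [norm_mul, norm_mul]
    refine mul_le_mul_of_nonneg_right (mul_le_mul_of_nonneg_left ?_ (abs_nonneg a))
      (norm_nonneg _)
    rw [Real.norm_of_nonneg (by positivity), div_le_iff₀ (by positivity)]
    have : (1 + δ⁻¹) * (‖x‖ ^ 2 + δ) = ‖x‖ ^ 2 + δ + δ⁻¹ * ‖x‖ ^ 2 + 1 := by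
      field_simp
      ring
    rw [this]
    have : 0 ≤ δ⁻¹ * ‖x‖ ^ 2 := by positivity
    nlinarith [sq_nonneg (‖x‖ - 1), sq_nonneg ‖x‖]
  exact ⟨hw.of_le_mul (hc.aestronglyMeasurable.mul hw.1) hle,
    eLpNorm_le_mul_eLpNorm_of_ae_le_mul hle 2⟩

theorem IsTestLimit.eLpNorm_hardy_weight_le (hN : 2 ≤ N) {w : EuclideanSpace ℝ (Fin N) → ℝ}
    {G : EuclideanSpace ℝ (Fin N) → EuclideanSpace ℝ (Fin N)} (h : IsTestLimit Ω w G)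
    {δ : ℝ} (hδ : 0 < δ) :
    eLpNorm (fun x => ((N : ℝ) - 2) / 2 * (‖x‖ / (‖x‖ ^ 2 + δ)) * w x) 2 volume
      ≤ eLpNorm G 2 volume := by
  obtain ⟨φ, h1, h2⟩ := h.exists_seq
  set a : ℝ := ((N : ℝ) - 2) / 2 with ha
  have t := ((ENNReal.Tendsto.const_mul (a := ENNReal.ofReal (|a| * (1 + δ⁻¹))) h1
    (.inr ENNReal.ofReal_ne_top)).add (h2.add_const (eLpNorm G 2 volume)))
  rw [mul_zero, zero_add, zero_add] at t
  refine ge_of_tendsto' t fun n => ?_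
  have hφ := memLp_testFunction (φ n)
  have e1 : (fun x => a * (‖x‖ / (‖x‖ ^ 2 + δ)) * w x)
      = (fun x => a * (‖x‖ / (‖x‖ ^ 2 + δ)) * φ n x)
        - fun x => a * (‖x‖ / (‖x‖ ^ 2 + δ)) * (φ n x - w x) := by
    ext x
    simp only [Pi.sub_apply]
    ring
  have e2 : gradient (φ n) = (fun x => gradient (φ n) x - G x) + G := by ext; simp
  have b1 : eLpNorm (fun x => a * (‖x‖ / (‖x‖ ^ 2 + δ)) * φ n x) 2 volume
      ≤ eLpNorm (gradient (φ n)) 2 volume :=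
    (eLpNorm_two_le_iff (memLp_hardy_weight_mul hφ hδ a).1 (memLp_gradient (φ n))).2
      (integral_hardy_le hN (φ n).contDiff (φ n).hasCompactSupport hδ)
  have b2 := memLp_hardy_weight_mul (hφ.sub h.memLp) hδ a
  have b3 : eLpNorm (gradient (φ n)) 2 volume
      ≤ eLpNorm (fun x => gradient (φ n) x - G x) 2 volume + eLpNorm G 2 volume :=
    le_of_eq_of_le (congrArg (fun k => eLpNorm k 2 volume) e2)
      (eLpNorm_add_le ((memLp_gradient (φ n)).1.sub h.memLp_grad.1) h.memLp_grad.1 (by norm_num))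
  rw [e1, add_comm]
  exact (eLpNorm_sub_le (memLp_hardy_weight_mul hφ hδ a).1.1 b2.1.1 (by norm_num)).trans
    (add_le_add (b1.trans b3) b2.2)

/-- Hardy's inequality in `H¹₀`. -/
theorem IsTestLimit.hardy (hN : 2 ≤ N) {w : EuclideanSpace ℝ (Fin N) → ℝ}
    {G : EuclideanSpace ℝ (Fin N) → EuclideanSpace ℝ (Fin N)} (h : IsTestLimit Ω w G) :
    MemLp (fun x => ((N : ℝ) - 2) / 2 * (w x / ‖x‖)) 2 volume ∧
    ∫ x, ‖((N : ℝ) - 2) / 2 * (w x / ‖x‖)‖ ^ 2 ≤ ∫ x, ‖G x‖ ^ 2 := by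
  set a : ℝ := ((N : ℝ) - 2) / 2 with ha
  have hpos : ∀ n : ℕ, (0 : ℝ) < 1 / ((n : ℝ) + 1) := fun n => by positivity
  have hε := tendsto_one_div_add_atTop_nhds_zero_nat (𝕜 := ℝ)
  -- Fatou's lemma along `δ = 1 / (n + 1)`, since the bound by the norm of `G` does not depend on
  -- `δ`. At `x = 0` all the functions vanish by the convention for division by zero.
  have hle : eLpNorm (fun x => a * (w x / ‖x‖)) 2 volume ≤ eLpNorm G 2 volume := by
    refine (Lp.eLpNorm_lim_le_liminf_eLpNorm
      (f := fun (n : ℕ) x => a * (‖x‖ / (‖x‖ ^ 2 + 1 / ((n : ℝ) + 1))) * w x)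
      (fun n => (memLp_hardy_weight_mul h.memLp (hpos n) a).1.1) _
      (.of_forall fun x => ?_)).trans ?_
    · rcases eq_or_ne x 0 with rfl | hx
      · simp
      · have hx' : ‖x‖ ≠ 0 := norm_ne_zero_iff.2 hx
        have t := ((tendsto_const_nhds (x := ‖x‖).div (hε.const_add (‖x‖ ^ 2))
          (by simpa using hx)).const_mul a).mul_const (w x)
        have e : a * (w x / ‖x‖) = a * (‖x‖ / (‖x‖ ^ 2 + 0)) * w x := by
          rw [add_zero]
          field_simp
        rw [e]
        exact t
    · refine liminf_le_of_le (by isBoundedDefault) fun b hb => ?_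
      obtain ⟨n, hn⟩ := hb.exists
      exact hn.trans (h.eLpNorm_hardy_weight_le hN (hpos n))
  have hm : MemLp (fun x => a * (w x / ‖x‖)) 2 volume :=
    ⟨(h.memLp.1.aemeasurable.div measurable_norm.aemeasurable).const_mul a
      |>.aestronglyMeasurable, hle.trans_lt h.memLp_grad.2⟩
  exact ⟨hm, (eLpNorm_two_le_iff hm h.memLp_grad).1 hle⟩

/-! ### Signs of the terms tested against the negative part. -/

theorem sub_mul_negPart_sub_nonpos (a b : ℝ) : (a - b) * (max (-a) 0 - max (-b) 0) ≤ 0 := by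
  rcases le_total a b with h | h
  · exact mul_nonpos_of_nonpos_of_nonneg (sub_nonpos.2 h)
      (sub_nonneg.2 (max_le_max_right 0 (neg_le_neg h)))
  · exact mul_nonpos_of_nonneg_of_nonpos (sub_nonneg.2 h)
      (sub_nonpos.2 (max_le_max_right 0 (neg_le_neg h)))

/-- The integrand is pointwise nonpositive, so finiteness of the double integral plays no role. -/
theorem gagliardoInner_negPart_nonpos (s : ℝ) (u : EuclideanSpace ℝ (Fin N) → ℝ) :
    gagliardoInner s u (fun x => max (-u x) 0) ≤ 0 :=
  integral_nonpos fun _ => div_nonpos_of_nonpos_of_nonneg (sub_mul_negPart_sub_nonpos _ _)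
    (Real.rpow_nonneg (norm_nonneg _) _)

/-- Positivity of `r` matters where `t < 0`, because `0 ^ 0 = 1`. -/
theorem posPart_rpow_mul_negPart {r : ℝ} (hr : 0 < r) (t : ℝ) :
    max t 0 ^ r * max (-t) 0 = 0 := by
  rcases le_total t 0 with h | h
  · rw [max_eq_right h, Real.zero_rpow hr.ne', zero_mul]
  · rw [max_eq_right (neg_nonpos.2 h), mul_zero]

theorem mul_negPart_div_sq (t r : ℝ) :
    t * max (-t) 0 / r ^ 2 = -(max (-t) 0 / r) ^ 2 := by
  rcases le_total t 0 with h | h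
  · rw [max_eq_left (neg_nonneg.2 h)]; ring
  · rw [max_eq_right (neg_nonpos.2 h)]; simp

/-- A slope `σ ∈ [-1, 0]` satisfies `σ ≤ -σ²`. The inequality covers the value `-1/2` at `t = 0`, so
`∇u = 0` a.e. on `{u = 0}` is not needed. -/
theorem inner_negPartSlope_smul_le (t : ℝ) (v : EuclideanSpace ℝ (Fin N)) :
    inner ℝ v (negPartSlope t • v) ≤ -‖negPartSlope t • v‖ ^ 2 := by
  rw [inner_smul_right, real_inner_self_eq_norm_sq, norm_smul, mul_pow, Real.norm_eq_abs, sq_abs]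
  have h1 := negPartSlope_nonpos t
  have h2 := (abs_le.1 (abs_negPartSlope_le t)).1
  have : negPartSlope t * (1 + negPartSlope t) * ‖v‖ ^ 2 ≤ 0 :=
    mul_nonpos_of_nonpos_of_nonneg (mul_nonpos_of_nonpos_of_nonneg h1 (by linarith))
      (sq_nonneg _)
  linarith

theorem one_lt_criticalExponent (hN : 3 ≤ N) : 1 < criticalExponent N := by
  have : (3 : ℝ) ≤ N := by exact_mod_cast hN
  rw [criticalExponent, lt_div_iff₀ (by linarith)]
  linarith

/-- The Dirichlet energy of the negative part. -/
theorem MemX.setIntegral_inner_negPart_le {u : EuclideanSpace ℝ (Fin N) → ℝ} (h : MemX Ω u)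
    {G : EuclideanSpace ℝ (Fin N) → EuclideanSpace ℝ (Fin N)}
    (hG : G = (Ω : Set (EuclideanSpace ℝ (Fin N))).indicator (weakGradient Ω u)) :
    ∫ x in (Ω : Set (EuclideanSpace ℝ (Fin N))),
        inner ℝ (weakGradient Ω u x) (weakGradient Ω (fun x => max (-u x) 0) x)
      ≤ - ∫ x, ‖negPartSlope (u x) • G x‖ ^ 2 := by
  have hu := h.isTestLimit
  rw [← hG] at hu
  have hm : MeasurableSet (Ω : Set (EuclideanSpace ℝ (Fin N))) := Ω.isOpen.measurableSet
  have h1 : ∫ x in (Ω : Set (EuclideanSpace ℝ (Fin N))),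
        inner ℝ (weakGradient Ω u x) (weakGradient Ω (fun x => max (-u x) 0) x)
      = ∫ x, inner ℝ (G x) (negPartSlope (u x) • G x) := by
    have h0 : ∀ x ∉ (Ω : Set (EuclideanSpace ℝ (Fin N))),
        inner ℝ (G x) (negPartSlope (u x) • G x) = 0 := fun x hx => by
      rw [hG, Set.indicator_of_notMem hx, inner_zero_left]
    rw [← setIntegral_eq_integral_of_forall_compl_eq_zero h0]
    refine integral_congr_ae ?_
    filter_upwards [hu.negPart.weakGradient_ae_eq, ae_restrict_mem hm] with x hx hxΩ
    rw [hx, hG, Set.indicator_of_mem hxΩ]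
  have hi : Integrable (fun x => inner ℝ (G x) (negPartSlope (u x) • G x)) volume :=
    (hu.memLp_grad.norm.integrable_mul hu.negPart.memLp_grad.norm).mono'
      (hu.memLp_grad.1.inner hu.negPart.memLp_grad.1)
      (.of_forall fun x => norm_inner_le_norm _ _)
  rw [h1, ← integral_neg]
  exact integral_mono hi (hu.negPart.memLp_grad.integrable_norm_pow two_ne_zero).neg
    fun x => inner_negPartSlope_smul_le (u x) (G x)

end MixedHardy

end

/-! ### The maximum principle. -/

open MeasureTheory MixedHardy in
theorem mainTheorem8 (N : ℕ) (hN : 3 ≤ N) (Ω : TopologicalSpace.Opens (EuclideanSpace ℝ (Fin N)))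
    (hΩb : Bornology.IsBounded (Ω : Set (EuclideanSpace ℝ (Fin N))))
    (hΩ0 : (0 : EuclideanSpace ℝ (Fin N)) ∈ Ω)
    (s μ lam p : ℝ) (hs0 : 0 < s) (hs1 : s < 1)
    (hμ0 : 0 < μ) (hμ1 : μ < MixedHardy.hardyConstant N) (hlam : 0 < lam)
    (hp1 : 1 < p) (hp2 : p < MixedHardy.criticalExponent N)
    (u : EuclideanSpace ℝ (Fin N) → ℝ)
    (hu : MixedHardy.IsWeakSupersolution Ω s μ lam p u) :
    ∀ᵐ x ∂(MeasureTheory.volume.restrict (Ω : Set (EuclideanSpace ℝ (Fin N)))), 0 ≤ u x := by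
  obtain ⟨hX, hsup⟩ := hu
  obtain ⟨G, hG⟩ : ∃ G, G = (Ω : Set (EuclideanSpace ℝ (Fin N))).indicator (weakGradient Ω u) :=
    ⟨_, rfl⟩
  have hlim := hX.isTestLimit
  rw [← hG] at hlim
  have hw := hlim.negPart
  obtain ⟨hHm, hH⟩ := hw.hardy (by omega)
  have ha : (0 : ℝ) < ((N : ℝ) - 2) / 2 := by
    have : (3 : ℝ) ≤ N := by exact_mod_cast hN
    linarith
  have hsup := hsup _ hw.memX (.of_forall fun x => le_max_right _ _)
  -- The left side becomes `0`; positivity of the exponents `2* - 1` and `p - 1` enters here.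
  simp only [posPart_rpow_mul_negPart (sub_pos.2 (one_lt_criticalExponent hN)),
    posPart_rpow_mul_negPart (sub_pos.2 hp1), integral_zero, mul_negPart_div_sq,
    integral_neg] at hsup
  have hgag := gagliardoInner_negPart_nonpos s u
  have hgrad := hX.setIntegral_inner_negPart_le hG
  have hqm : MemLp (fun x => max (-u x) 0 / ‖x‖) 2 volume := by
    refine (hHm.const_mul (((N : ℝ) - 2) / 2)⁻¹).ae_eq (.of_forall fun x => ?_)
    exact inv_mul_cancel_left₀ ha.ne' _
  have hqi : Integrable (fun x => (max (-u x) 0 / ‖x‖) ^ 2) volume := hqm.integrable_sq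
  have hset : ∫ x in (Ω : Set (EuclideanSpace ℝ (Fin N))), (max (-u x) 0 / ‖x‖) ^ 2
      ≤ ∫ x, (max (-u x) 0 / ‖x‖) ^ 2 :=
    setIntegral_le_integral hqi (.of_forall fun x => sq_nonneg _)
  have hH' : hardyConstant N * ∫ x, (max (-u x) 0 / ‖x‖) ^ 2
      ≤ ∫ x, ‖negPartSlope (u x) • G x‖ ^ 2 := by
    refine le_of_eq_of_le ?_ hH
    rw [← integral_const_mul]
    refine integral_congr_ae (.of_forall fun x => ?_)
    simp only [Real.norm_eq_abs, sq_abs, mul_pow, hardyConstant]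
  have hnn : 0 ≤ ∫ x, (max (-u x) 0 / ‖x‖) ^ 2 := integral_nonneg fun x => sq_nonneg _
  have hzero : ∫ x, (max (-u x) 0 / ‖x‖) ^ 2 = 0 := by
    have h1 := mul_le_mul_of_nonneg_left hset hμ0.le
    -- Chain: `hardyConstant N * I ≤ ∫ |∇u⁻|² ≤ μ ∫_Ω (u⁻)² / |x|² ≤ μ * I`, with `I` the integral
    -- over `ℝᴺ`.
    have h2 : (hardyConstant N - μ) * ∫ x, (max (-u x) 0 / ‖x‖) ^ 2 ≤ 0 := by linarith
    exact le_antisymm (nonpos_of_mul_nonpos_right h2 (sub_pos.2 hμ1)) hnn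
  rw [integral_eq_zero_iff_of_nonneg (fun x => sq_nonneg _) hqi] at hzero
  -- Makes the space nontrivial, so that the origin, where the quotient carries no information, is a
  -- null set.
  have : Nonempty (Fin N) := ⟨⟨0, by omega⟩⟩
  have hne : ∀ᵐ x : EuclideanSpace ℝ (Fin N), x ≠ 0 := Measure.ae_ne volume 0
  refine ae_restrict_of_ae ?_
  filter_upwards [hzero, hne] with x hx hx0
  have h0 : max (-u x) 0 = 0 := by
    have := pow_eq_zero_iff (two_ne_zero) |>.1 hx
    exact (div_eq_zero_iff.1 this).resolve_right (norm_ne_zero_iff.2 hx0)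
  linarith [le_max_left (-u x) 0]
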